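/- Let $t\in\mathbb{C}^\times$ with a fixed square root $t^{1/2}$. For $n\ge 1$ and $q\in\mathbb{C}^\times$ let $$T_i=-t^{-1/2}(t z_i-z_{i+1})\,\partial_i+t^{1/2},\qquad \partial_i F=\frac{F-s_iF}{z_i-z_{i+1}}\qquad(1\le i\le n-1)$$ be the Demazure–Lusztig operators on $\mathbb{C}[z_1,\dots,z_n]$, where $s_i$ exchanges $z_i$ and $z_{i+1}$; they are invertible. Put $(\pi F)(z_1,\dots,z_n)=F(q z_n,z_1,\dots,z_{n-1})$ and let $$Y_i=T_i\cdots T_{n-1}\,\pi\,T_1^{-1}\cdots T_{i-1}^{-1}\qquad(1\le i\le n)$$ be the Cherednik operators in $n$ variables with parameters $(q,t^{1/2})$. Let $1\le m\le M\le N$. Let $Y_m^\circ$ be the $m$th Cherednik operator in $N$ variables with parameters $q=1$ and $t^{1/2}$, and let $Y'_m$ be the $m$th Cherednik operator in $M$ variables with parameters $q'=t'=t^{-1}$, where $t'^{1/2}=t^{-1/2}$. Put $$\Delta_t=t^{-M(M-1)/4}\prod_{1\le i<j\le M}(t z_i-z_j),$$ and let $\mathbb{C}[z_1,\dots,z_M]^{<N-M+1}$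 be the space of polynomials of degree at most $N-M$ in each variable. Then $Y'_m$ preserves $\mathbb{C}[z_1,\dots,z_M]^{<N-M+1}$, so that $\Delta_t Y'_m\Delta_t^{-1}$ acts on $\Delta_t\,\mathbb{C}[z_1,\dots,z_M]^{<N-M+1}\subset\mathbb{C}[z_1,\dots,z_N]$, and on the latter space $$Y_m^\circ\ \overset{\mathrm{ev}}{=}\ t^{(N-M)/2}\,\Delta_t\,Y'_m\,\Delta_t^{-1}.$$ That is, for every $P\in\mathbb{C}[z_1,\dots,z_M]^{<N-M+1}$ the polynomials $Y_m^\circ(\Delta_t P)$ and $t^{(N-M)/2}\,\Delta_t\,Y'_m P$ in $z_1,\dots,z_N$ take the same value under the evaluation $z_j\mapsto\omega^j$, $1\le j\le N$, where $\omega=e^{2\pi i/N}$; more generally they take the same value under $z_j\mapsto\omega^{\sigma(j)}$ for every permutation $\sigma$ of $\{1,\dots,N\}$. -/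

import Mathlib

noncomputable section

namespace QHS

open MvPolynomial

/-- The transposition `z_i ↔ z_j` acting on polynomials. -/
def swapVar {N : ℕ} (i j : Fin N) : MvPolynomial (Fin N) ℂ →ₐ[ℂ] MvPolynomial (Fin N) ℂ :=
  rename (Equiv.swap i j)

theorem swapVar_swapVar {N : ℕ} (i j : Fin N) (F : MvPolynomial (Fin N) ℂ) :
    swapVar i j (swapVar i j F) = F := by
  have h : (Equiv.swap i j : Fin N → Fin N) ∘ Equiv.swap i j = id := by
    funext k; simp
  simp [swapVar, rename_rename, h]

theorem X_sub_X_ne_zero {N : ℕ} {i j : Fin N} (h : i ≠ j) :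
    (X i - X j : MvPolynomial (Fin N) ℂ) ≠ 0 :=
  sub_ne_zero.2 fun e => h (X_injective e)

theorem X_sub_X_dvd {N : ℕ} (i j : Fin N) (F : MvPolynomial (Fin N) ℂ) :
    X i - X j ∣ F - swapVar i j F := by
  induction F using MvPolynomial.induction_on with
  | C a => simp [swapVar]
  | add p q hp hq =>
    have e : p + q - swapVar i j (p + q) = (p - swapVar i j p) + (q - swapVar i j q) := by
      rw [map_add]; ring
    rw [e]; exact dvd_add hp hq
  | mul_X p k hp =>
    have hk : (X i - X j : MvPolynomial (Fin N) ℂ) ∣ X k - swapVar i j (X k) := by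
      rcases eq_or_ne k i with rfl | hi
      · simp [swapVar]
      · rcases eq_or_ne k j with rfl | hj
        · simpa [swapVar] using (dvd_sub_comm).1 (dvd_refl (X i - X k : MvPolynomial (Fin N) ℂ))
        · simp [swapVar, Equiv.swap_apply_of_ne_of_ne hi hj]
    have e : p * X k - swapVar i j (p * X k) =
        (p - swapVar i j p) * X k + swapVar i j p * (X k - swapVar i j (X k)) := by
      rw [map_mul]; ring
    rw [e]; exact dvd_add (hp.mul_right _) (hk.mul_left _)

/-- The divided difference `(F - s_{ij} F) / (z_i - z_j)`, the exact quotient in the polynomial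
ring. -/
def divDiffFun {N : ℕ} (i j : Fin N) (F : MvPolynomial (Fin N) ℂ) : MvPolynomial (Fin N) ℂ :=
  (X_sub_X_dvd i j F).choose

theorem X_sub_X_mul_divDiffFun {N : ℕ} (i j : Fin N) (F : MvPolynomial (Fin N) ℂ) :
    (X i - X j) * divDiffFun i j F = F - swapVar i j F :=
  (X_sub_X_dvd i j F).choose_spec.symm

/-- The divided difference as a linear operator. -/
def divDiff {N : ℕ} (i j : Fin N) (h : i ≠ j) : Module.End ℂ (MvPolynomial (Fin N) ℂ) where
  toFun := divDiffFun i j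
  map_add' F G := by
    apply mul_left_cancel₀ (X_sub_X_ne_zero h)
    rw [mul_add]
    simp only [X_sub_X_mul_divDiffFun, map_add]
    ring
  map_smul' c F := by
    apply mul_left_cancel₀ (X_sub_X_ne_zero h)
    rw [RingHom.id_apply, mul_smul_comm]
    simp only [X_sub_X_mul_divDiffFun, map_smul, smul_sub]

theorem X_sub_X_mul_divDiff {N : ℕ} (i j : Fin N) (h : i ≠ j) (F : MvPolynomial (Fin N) ℂ) :
    (X i - X j) * divDiff i j h F = F - swapVar i j F :=
  X_sub_X_mul_divDiffFun i j F

/-- The Demazure--Lusztig operator `-t^{-1/2} (t z_i - z_j) ∂_{ij} + t^{1/2}`, where `s` stands for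
`t^{1/2}`. -/
def demazureLusztig {N : ℕ} (s : ℂˣ) (i j : Fin N) (h : i ≠ j) :
    Module.End ℂ (MvPolynomial (Fin N) ℂ) :=
  -((s : ℂ)⁻¹ • (LinearMap.mulLeft ℂ (C ((s : ℂ) ^ 2) * X i - X j) * divDiff i j h)) +
    (s : ℂ) • 1

theorem demazureLusztig_apply {N : ℕ} (s : ℂˣ) (i j : Fin N) (h : i ≠ j)
    (F : MvPolynomial (Fin N) ℂ) :
    demazureLusztig s i j h F =
      -(C (s : ℂ)⁻¹ * ((C ((s : ℂ) ^ 2) * X i - X j) * divDiff i j h F)) + C (s : ℂ) * F := by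
  simp [demazureLusztig, smul_eq_C_mul]

theorem swapVar_divDiff {N : ℕ} (i j : Fin N) (h : i ≠ j) (F : MvPolynomial (Fin N) ℂ) :
    swapVar i j (divDiff i j h F) = divDiff i j h F := by
  apply mul_left_cancel₀ (X_sub_X_ne_zero h)
  have e := congrArg (swapVar i j) (X_sub_X_mul_divDiff i j h F)
  rw [map_mul, map_sub, map_sub, swapVar_swapVar] at e
  have hi : swapVar i j (X i) = X j := by simp [swapVar]
  have hj : swapVar i j (X j) = X i := by simp [swapVar]
  rw [hi, hj] at e
  rw [X_sub_X_mul_divDiff]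
  linear_combination -e

/-- The Hecke condition `(T - t^{1/2}) (T + t^{-1/2}) = 0`. -/
theorem hecke_condition {N : ℕ} (s : ℂˣ) (i j : Fin N) (h : i ≠ j) :
    (demazureLusztig s i j h - (s : ℂ) • 1) * (demazureLusztig s i j h + (s : ℂ)⁻¹ • 1) = 0 := by
  have key : ∀ F, divDiff i j h (demazureLusztig s i j h F + C (s : ℂ)⁻¹ * F) = 0 := by
    intro F
    apply mul_left_cancel₀ (X_sub_X_ne_zero h)
    have hi : swapVar i j (X i) = X j := by simp [swapVar]
    have hj : swapVar i j (X j) = X i := by simp [swapVar]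
    have hC : ∀ c : ℂ, swapVar i j (C c) = C c := fun c => by simp [swapVar]
    have e := X_sub_X_mul_divDiff i j h F
    have hs : (C (s : ℂ) : MvPolynomial (Fin N) ℂ) * C (s : ℂ)⁻¹ = 1 := by
      rw [← C_mul, mul_inv_cancel₀ s.ne_zero, C_1]
    rw [X_sub_X_mul_divDiff, demazureLusztig_apply]
    simp only [map_add, map_neg, map_mul, map_sub, hi, hj, hC, swapVar_divDiff, map_pow]
    linear_combination (-(C (s : ℂ) + C (s : ℂ)⁻¹)) * e -
      (C (s : ℂ) * (X i - X j) * divDiff i j h F) * hs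
  refine LinearMap.ext fun F => ?_
  have k := key F
  generalize hG : demazureLusztig s i j h F + C (s : ℂ)⁻¹ * F = G at k
  have : (demazureLusztig s i j h + (s : ℂ)⁻¹ • 1) F = G := by
    simp [← hG, smul_eq_C_mul]
  rw [Module.End.mul_apply, this]
  simp [demazureLusztig_apply, k, smul_eq_C_mul]

theorem hecke_mul_inv {N : ℕ} (s : ℂˣ) (i j : Fin N) (h : i ≠ j) :
    demazureLusztig s i j h * (demazureLusztig s i j h - ((s : ℂ) - (s : ℂ)⁻¹) • 1) = 1 := by
  have e := hecke_condition s i j h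
  have c : (s : ℂ) • ((s : ℂ)⁻¹ • (1 : Module.End ℂ (MvPolynomial (Fin N) ℂ))) = 1 := by
    rw [smul_smul, mul_inv_cancel₀ s.ne_zero, one_smul]
  rw [sub_mul, smul_mul_assoc, one_mul, mul_add, mul_smul_comm, mul_one, smul_add, c] at e
  rw [mul_sub, mul_smul_comm, mul_one]
  rw [← sub_eq_zero, ← e]
  module

theorem hecke_inv_mul {N : ℕ} (s : ℂˣ) (i j : Fin N) (h : i ≠ j) :
    (demazureLusztig s i j h - ((s : ℂ) - (s : ℂ)⁻¹) • 1) * demazureLusztig s i j h = 1 := by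
  have e := hecke_mul_inv s i j h
  rw [mul_sub, mul_smul_comm, mul_one] at e
  rw [sub_mul, smul_mul_assoc, one_mul, e]

/-- The Hecke generator exchanging the neighbouring (zero-based) positions `k` and `k + 1`, as an
invertible operator on polynomials. -/
def heckeT {N : ℕ} (s : ℂˣ) (k : ℕ) (hk : k + 1 < N) :
    (Module.End ℂ (MvPolynomial (Fin N) ℂ))ˣ where
  val := demazureLusztig s ⟨k, by omega⟩ ⟨k + 1, hk⟩ (by simp)
  inv := demazureLusztig s ⟨k, by omega⟩ ⟨k + 1, hk⟩ (by simp) - ((s : ℂ) - (s : ℂ)⁻¹) • 1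
  val_inv := hecke_mul_inv s _ _ _
  inv_val := hecke_inv_mul s _ _ _

/-- The twisted cyclic shift `(π F)(z_1, …, z_N) = F(q z_N, z_1, …, z_{N-1})`. -/
def cyclicShift (N : ℕ) (q : ℂ) : Module.End ℂ (MvPolynomial (Fin N) ℂ) :=
  (aeval fun j : Fin N =>
    if (j : ℕ) = 0 then C q * X (⟨N - 1, by have := j.2; omega⟩ : Fin N)
    else X (⟨(j : ℕ) - 1, by have := j.2; omega⟩ : Fin N)).toLinearMap

/-- The Cherednik operator
`Y_i = T_i T_{i+1} ⋯ T_{N-1} π T_1⁻¹ ⋯ T_{i-1}⁻¹` in `N` variables, with Hecke parameter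
`s = t^{1/2}` and shift parameter `q`. The index `i` is zero-based: `cherednikY s q i` is the
operator commonly written `Y_{i+1}`. -/
def cherednikY {N : ℕ} (s : ℂˣ) (q : ℂ) (i : Fin N) : Module.End ℂ (MvPolynomial (Fin N) ℂ) :=
  (List.ofFn fun k : Fin (N - 1 - i) =>
      (heckeT (N := N) s (i + k) (by have := k.2; omega) :
        Module.End ℂ (MvPolynomial (Fin N) ℂ))).prod
    * cyclicShift N q
    * (List.ofFn fun k : Fin i =>
      (((heckeT (N := N) s k (by have := k.2; have := i.2; omega))⁻¹ :
        (Module.End ℂ (MvPolynomial (Fin N) ℂ))ˣ) :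
          Module.End ℂ (MvPolynomial (Fin N) ℂ))).prod

/-- The deformed Vandermonde polynomial `Δ_t = t^{-M(M-1)/4} ∏_{i<j} (t z_i - z_j)` in `M`
variables, with `s = t^{1/2}`. -/
def qVandermonde (M : ℕ) (s : ℂˣ) : MvPolynomial (Fin M) ℂ :=
  C ((s : ℂ)⁻¹ ^ (M * (M - 1) / 2)) *
    ∏ i : Fin M, ∏ j ∈ Finset.Ioi i, (C ((s : ℂ) ^ 2) * X i - X j)

/-- The inclusion `ℂ[z_1, …, z_M] ⊂ ℂ[z_1, …, z_N]`. -/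
def incl {M N : ℕ} (h : M ≤ N) : MvPolynomial (Fin M) ℂ →ₐ[ℂ] MvPolynomial (Fin N) ℂ :=
  rename (Fin.castLE h)

/-- Evaluation of a polynomial at the `N`th roots of unity, `z_j ↦ ω^{σ(j)}` with
`ω = exp(2πi/N)`, for a permutation `σ` of the labels `1, …, N`; the label `j` is
`⟨j - 1, _⟩ : Fin N`. For `σ = 1` it is `z_j ↦ ω^j`. -/
def ev (N : ℕ) (σ : Equiv.Perm (Fin N)) : MvPolynomial (Fin N) ℂ →ₐ[ℂ] ℂ :=
  aeval fun j : Fin N => Complex.exp (2 * Real.pi * Complex.I / N) ^ ((σ j : ℕ) + 1)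

end QHS

end

noncomputable section

namespace QHS

open MvPolynomial

/-! Write `t = s²`, with one-based indices here. For `i < M`, moving `T_i` past `Δ_t` turns it into
`-T'_i`, taken at parameter `t⁻¹` (`demazureLusztig_qVandermonde_mul`). The factors of `Y_m°` acting
on the first `M` variables therefore become those of `Y'_m` up to sign. What remains is `T_M ⋯
T_{N-1} π (Δ_t Q) = (-1)^{M-1} t^{(N-M)/2} Δ_t π' Q` at the roots of unity
(`prod_heckeOrOne_cyclicShift_sub_mem_rootKernel`).

At `q = 1`, `π (Δ_t Q)` involves only the first `M - 1` variables and the last one. Each `T` in the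
chain adds one node, so the value at `w` is a sum over the nodes `w_M, …, w_N`
(`aeval_prod_heckeOrOne`). For distinct `N`th roots of unity, `∏_{l≠M} (t w_j - w_l) = t^{N-1}
∏_{l≠j} (t⁻¹ w_M - w_l)` (`IsRootPoint.prod_erase_dual`). This turns the sum into Lagrange
interpolation of `Q` in its first variable, exact because the degree is at most `N - M`, evaluated
at `t⁻¹ w_M`: hence `q' = t⁻¹`.

The remaining factors on the left respect equality at the roots, because `T_i` preserves the
polynomials vanishing at all arrangements of them (`heckeOrOne_mem_rootKernel`). -/

/-! ### Conjugation of Hecke generators by the deformed Vandermonde polynomial -/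

theorem X_sub_X_mul_demazureLusztig {N : ℕ} (s : ℂˣ) (i j : Fin N) (h : i ≠ j)
    (F : MvPolynomial (Fin N) ℂ) :
    (X i - X j) * demazureLusztig s i j h F =
      C (s : ℂ)⁻¹ * ((1 - C ((s : ℂ) ^ 2)) * X j * F +
        (C ((s : ℂ) ^ 2) * X i - X j) * swapVar i j F) := by
  have e := X_sub_X_mul_divDiff i j h F
  have hs : (C (s : ℂ)⁻¹ : MvPolynomial (Fin N) ℂ) * C ((s : ℂ) ^ 2) = C (s : ℂ) := by
    rw [← C_mul, pow_two, inv_mul_cancel_left₀ s.ne_zero]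
  rw [demazureLusztig_apply]
  linear_combination (-C (s : ℂ)⁻¹ * (C ((s : ℂ) ^ 2) * X i - X j)) * e
    + (X j - X i) * F * hs

/-- The Demazure--Lusztig operators commute with the inclusion of fewer variables. -/
theorem incl_demazureLusztig {M N : ℕ} (hMN : M ≤ N) (s : ℂˣ) (i j : Fin M) (h : i ≠ j)
    (h' : Fin.castLE hMN i ≠ Fin.castLE hMN j) (F : MvPolynomial (Fin M) ℂ) :
    incl hMN (demazureLusztig s i j h F) = demazureLusztig s _ _ h' (incl hMN F) := by
  apply mul_left_cancel₀ (X_sub_X_ne_zero h')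
  rw [X_sub_X_mul_demazureLusztig]
  have e := congrArg (incl hMN) (X_sub_X_mul_demazureLusztig s i j h F)
  have hsw : incl hMN (swapVar i j F) =
      swapVar (Fin.castLE hMN i) (Fin.castLE hMN j) (incl hMN F) := by
    simp only [incl, swapVar, rename_rename]
    congr 2
    funext k
    simp [(Fin.castLE_injective hMN).map_swap]
  have hX : ∀ k, incl hMN (X k) = X (Fin.castLE hMN k) := fun k => by simp [incl]
  have hC : ∀ c, incl hMN (C c) = C c := fun k => by simp [incl]
  simpa only [map_mul, map_sub, map_add, map_one, hX, hC, hsw] using e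

/-- Indexing by pairs lets a transposition of variables act on the index set of the product. -/
theorem qVandermonde_eq {M : ℕ} (s : ℂˣ) :
    qVandermonde M s = C ((s : ℂ)⁻¹ ^ (M * (M - 1) / 2)) *
      ∏ p : Fin M × Fin M with p.1 < p.2, (C ((s : ℂ) ^ 2) * X p.1 - X p.2) := by
  rw [qVandermonde, Finset.prod_sigma']
  congr 1
  refine Finset.prod_bij' (fun p _ => (p.1, p.2)) (fun p _ => ⟨p.1, p.2⟩) ?_ ?_ ?_ ?_ ?_ <;> simp

/-- The deformed Vandermonde polynomial is a symmetric polynomial times `t z_i - z_{i+1}`. -/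
theorem swapVar_qVandermonde {M : ℕ} (s : ℂˣ) (k : ℕ) (hk : k + 1 < M) :
    (C ((s : ℂ) ^ 2) * X ⟨k, by omega⟩ - X ⟨k + 1, hk⟩) *
        swapVar ⟨k, by omega⟩ ⟨k + 1, hk⟩ (qVandermonde M s) =
      (C ((s : ℂ) ^ 2) * X ⟨k + 1, hk⟩ - X ⟨k, by omega⟩) * qVandermonde M s := by
  set i : Fin M := ⟨k, by omega⟩ with hi
  set j : Fin M := ⟨k + 1, hk⟩ with hj
  set A : Finset (Fin M × Fin M) := {p | p.1 < p.2} with hA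
  have hmem : (i, j) ∈ A := by simp [hA, hi, hj]
  set f : Fin M × Fin M → MvPolynomial (Fin M) ℂ :=
    fun p => C ((s : ℂ) ^ 2) * X p.1 - X p.2 with hf
  have hsw : ∀ p, swapVar i j (f p) = f (Equiv.swap i j p.1, Equiv.swap i j p.2) := by
    intro p; simp [hf, swapVar]
  -- Since `i` and `j` are adjacent, the transposition reverses the order of no pair except `(i,
  -- j)`.
  have hmaps : ∀ p ∈ A.erase (i, j), (Equiv.swap i j p.1, Equiv.swap i j p.2) ∈ A.erase (i, j) := by
    rintro ⟨⟨a, ha⟩, ⟨b, hb⟩⟩ hp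
    simp only [hA, hi, hj, Finset.mem_erase, Finset.mem_filter, Finset.mem_univ, true_and, ne_eq,
      Prod.mk.injEq, Fin.mk.injEq, Fin.mk_lt_mk, Equiv.swap_apply_def] at hp ⊢
    split_ifs <;> simp only [Fin.mk.injEq, Fin.mk_lt_mk] <;> omega
  have hprod : ∏ p ∈ A.erase (i, j), f (Equiv.swap i j p.1, Equiv.swap i j p.2) =
      ∏ p ∈ A.erase (i, j), f p := by
    refine Finset.prod_bij' (fun p _ => (Equiv.swap i j p.1, Equiv.swap i j p.2))
      (fun p _ => (Equiv.swap i j p.1, Equiv.swap i j p.2)) hmaps hmaps ?_ ?_ ?_ <;> simp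
  have hC : ∀ c, swapVar i j (C c) = C c := fun c => by simp [swapVar]
  rw [qVandermonde_eq, ← Finset.mul_prod_erase A f hmem, map_mul, map_mul, map_prod, hC]
  simp only [hsw, hprod]
  simp only [hf, Equiv.swap_apply_left, Equiv.swap_apply_right]
  ring

/-- Conjugation by the deformed Vandermonde polynomial exchanges `T_i` with `-T_i` at inverse
parameter. -/
theorem demazureLusztig_qVandermonde_mul {M : ℕ} (s : ℂˣ) (k : ℕ) (hk : k + 1 < M)
    (h : (⟨k, by omega⟩ : Fin M) ≠ ⟨k + 1, hk⟩) (F : MvPolynomial (Fin M) ℂ) :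
    demazureLusztig s ⟨k, by omega⟩ ⟨k + 1, hk⟩ h (qVandermonde M s * F) =
      -(qVandermonde M s * demazureLusztig s⁻¹ ⟨k, by omega⟩ ⟨k + 1, hk⟩ h F) := by
  have e := swapVar_qVandermonde s k hk
  apply mul_left_cancel₀ (X_sub_X_ne_zero h)
  have e' := X_sub_X_mul_demazureLusztig s⁻¹ _ _ h F
  rw [X_sub_X_mul_demazureLusztig, map_mul]
  have h1 : (C (s : ℂ)⁻¹ : MvPolynomial (Fin M) ℂ) * C (s : ℂ) = 1 := by
    rw [← C_mul, inv_mul_cancel₀ s.ne_zero, C_1]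
  simp only [Units.val_inv_eq_inv_val, inv_inv, map_pow, inv_pow] at e e' ⊢
  have h2 : (C ((s : ℂ) ^ 2)⁻¹ : MvPolynomial (Fin M) ℂ) = C (s : ℂ)⁻¹ * C (s : ℂ)⁻¹ := by
    rw [← C_mul, pow_two, mul_inv]
  rw [h2] at e'
  generalize (C (s : ℂ)⁻¹ : MvPolynomial (Fin M) ℂ) = r at *
  generalize (C (s : ℂ) : MvPolynomial (Fin M) ℂ) = u at *
  generalize swapVar _ _ F = G at *
  generalize swapVar _ _ (qVandermonde M s) = D' at *
  generalize qVandermonde M s = D at *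
  generalize demazureLusztig s⁻¹ _ _ h F = T at *
  generalize (X ⟨k, _⟩ : MvPolynomial (Fin M) ℂ) = x at *
  generalize (X ⟨k + 1, hk⟩ : MvPolynomial (Fin M) ℂ) = y at *
  linear_combination D * e' + r * G * e + (u * y * D * (G - F) + r * D * (x * G - y * F)) * h1

/-! ### Cherednik operators as products over lists of positions -/

/-- The Hecke generator at position `k`, extended by `1` outside the range of positions. -/
def heckeOrOne (N : ℕ) (s : ℂˣ) (k : ℕ) : (Module.End ℂ (MvPolynomial (Fin N) ℂ))ˣ :=
  if hk : k + 1 < N then heckeT s k hk else 1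

/-- Lists of natural numbers, free of bound proofs, can be split and compared between `M` and `N`
variables. Every position listed is in range, so the default value `1` never enters. -/
theorem cherednikY_eq {N : ℕ} (s : ℂˣ) (q : ℂ) (i : Fin N) :
    cherednikY s q i =
      ((List.range' i (N - 1 - i)).map fun k => (heckeOrOne N s k).val).prod
        * cyclicShift N q
        * ((List.range i).map fun k => (heckeOrOne N s k)⁻¹.val).prod := by
  have h1 : (List.ofFn fun k : Fin (N - 1 - i) =>
      (heckeT (N := N) s (i + k) (by have := k.2; omega) :
        Module.End ℂ (MvPolynomial (Fin N) ℂ))) =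
      (List.range' i (N - 1 - i)).map fun k => (heckeOrOne N s k).val := by
    apply List.ext_getElem
    · simp
    · intro n h₁ h₂
      simp only [List.length_ofFn] at h₁
      have : (i : ℕ) + n + 1 < N := by omega
      simp [heckeOrOne, this]
  have h2 : (List.ofFn fun k : Fin i =>
      (((heckeT (N := N) s k (by have := k.2; have := i.2; omega))⁻¹ :
        (Module.End ℂ (MvPolynomial (Fin N) ℂ))ˣ) :
          Module.End ℂ (MvPolynomial (Fin N) ℂ))) =
      (List.range i).map fun k => (heckeOrOne N s k)⁻¹.val := by
    apply List.ext_getElem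
    · simp
    · intro n h₁ h₂
      simp only [List.length_ofFn] at h₁
      have : n + 1 < N := by have := i.2; omega
      simp [heckeOrOne, this]
  rw [cherednikY, h1, h2]

theorem heckeOrOne_incl_qVandermonde_mul {M N : ℕ} (hMN : M ≤ N) (s : ℂˣ) {k : ℕ} (hk : k + 1 < M)
    (F : MvPolynomial (Fin M) ℂ) :
    (heckeOrOne N s k).val (incl hMN (qVandermonde M s * F)) =
      -incl hMN (qVandermonde M s * (heckeOrOne M s⁻¹ k).val F) := by
  have hk' : k + 1 < N := by omega
  have h : (⟨k, by omega⟩ : Fin M) ≠ ⟨k + 1, hk⟩ := by simp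
  have h' : Fin.castLE hMN ⟨k, by omega⟩ ≠ Fin.castLE hMN ⟨k + 1, hk⟩ := by simp
  have e := incl_demazureLusztig hMN s _ _ h h' (qVandermonde M s * F)
  rw [demazureLusztig_qVandermonde_mul s k hk h F, map_neg] at e
  simpa [heckeOrOne, hk, hk', heckeT] using e.symm

theorem heckeOrOne_inv_incl_qVandermonde_mul {M N : ℕ} (hMN : M ≤ N) (s : ℂˣ) {k : ℕ}
    (hk : k + 1 < M) (F : MvPolynomial (Fin M) ℂ) :
    (heckeOrOne N s k)⁻¹.val (incl hMN (qVandermonde M s * F)) =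
      -incl hMN (qVandermonde M s * (heckeOrOne M s⁻¹ k)⁻¹.val F) := by
  have e := heckeOrOne_incl_qVandermonde_mul hMN s hk ((heckeOrOne M s⁻¹ k)⁻¹.val F)
  rw [← Module.End.mul_apply (heckeOrOne M s⁻¹ k).val, Units.mul_inv, Module.End.one_apply] at e
  rw [← neg_eq_iff_eq_neg] at e
  rw [← e, map_neg, ← Module.End.mul_apply, Units.inv_mul, Module.End.one_apply]

theorem prod_map_apply_of_anticomm {ι V W : Type*} [AddCommGroup V] [Module ℂ V]
    [AddCommGroup W] [Module ℂ W] (φ : V →ₗ[ℂ] W) (A : ι → Module.End ℂ W)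
    (B : ι → Module.End ℂ V) (l : List ι)
    (h : ∀ k ∈ l, ∀ v, A k (φ v) = -φ (B k v)) (v : V) :
    (l.map A).prod (φ v) = (-1 : ℂ) ^ l.length • φ ((l.map B).prod v) := by
  induction l with
  | nil => simp
  | cons k l ih =>
    rw [List.map_cons, List.prod_cons, Module.End.mul_apply,
      ih fun k hk => h k (List.mem_cons_of_mem _ hk), map_smul, h k List.mem_cons_self]
    simp [pow_succ]

/-- Multiplication by the deformed Vandermonde polynomial, followed by inclusion. -/
def vandermondeIncl {M N : ℕ} (hMN : M ≤ N) (s : ℂˣ) :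
    MvPolynomial (Fin M) ℂ →ₗ[ℂ] MvPolynomial (Fin N) ℂ :=
  (incl hMN).toLinearMap ∘ₗ LinearMap.mulLeft ℂ (qVandermonde M s)

theorem vandermondeIncl_apply {M N : ℕ} (hMN : M ≤ N) (s : ℂˣ) (F : MvPolynomial (Fin M) ℂ) :
    vandermondeIncl hMN s F = incl hMN (qVandermonde M s * F) := rfl

theorem prod_map_mem {ι V : Type*} [AddCommGroup V] [Module ℂ V] (W : Submodule ℂ V)
    (A : ι → Module.End ℂ V) (l : List ι) (h : ∀ k ∈ l, ∀ v ∈ W, A k v ∈ W) {v : V} (hv : v ∈ W) :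
    (l.map A).prod v ∈ W := by
  induction l with
  | nil => simpa
  | cons k l ih =>
    rw [List.map_cons, List.prod_cons, Module.End.mul_apply]
    exact h k List.mem_cons_self _ (ih fun k hk => h k (List.mem_cons_of_mem _ hk))

/-! ### Degrees -/

theorem mem_restrictDegree_iff_degreeOf {n d : ℕ} {F : MvPolynomial (Fin n) ℂ} :
    F ∈ restrictDegree (Fin n) ℂ d ↔ ∀ i, degreeOf i F ≤ d := by
  rw [mem_restrictDegree]
  simp only [degreeOf_le_iff]
  exact ⟨fun h i m hm => h m hm i, fun h m hm i => h i m hm⟩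

theorem degreeOf_X_sub_X {n : ℕ} {i j : Fin n} (h : i ≠ j) (k : Fin n) (c : ℂ) :
    degreeOf k (C c * X i - X j : MvPolynomial (Fin n) ℂ) ≤
      degreeOf k (X i - X j : MvPolynomial (Fin n) ℂ) := by
  have hX : ∀ l : Fin n, degreeOf k (X l : MvPolynomial (Fin n) ℂ) = if k = l then 1 else 0 :=
    fun l => degreeOf_X k l
  have hle : degreeOf k (C c * X i - X j : MvPolynomial (Fin n) ℂ) ≤
      if k = i ∨ k = j then 1 else 0 := by
    refine (degreeOf_sub_le _ _ _).trans (max_le ((degreeOf_C_mul_le _ _ _).trans ?_) ?_) <;>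
    · rw [hX]; split_ifs <;> simp_all
  refine hle.trans ?_
  split_ifs with hk
  · have key : ∀ l, (l = i ∨ l = j) → Finsupp.single l 1 ∈
        (X i - X j : MvPolynomial (Fin n) ℂ).support := by
      intro l hl
      rw [mem_support_iff, coeff_sub, coeff_X, coeff_X]
      rcases hl with rfl | rfl <;> simp [Finsupp.single_left_inj, h, h.symm]
    simpa using monomial_le_degreeOf k (key k hk)
  · exact Nat.zero_le _

theorem swapVar_mem_restrictDegree {n d : ℕ} (i j : Fin n) {F : MvPolynomial (Fin n) ℂ}
    (hF : F ∈ restrictDegree (Fin n) ℂ d) : swapVar i j F ∈ restrictDegree (Fin n) ℂ d := by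
  rw [mem_restrictDegree_iff_degreeOf] at hF ⊢
  intro k
  have := degreeOf_rename_of_injective (p := F) (Equiv.swap i j).injective (Equiv.swap i j k)
  rw [Equiv.swap_apply_self] at this
  rw [swapVar, this]
  exact hF _

/-- Multiplication by `c z_i - z_j` raises each partial degree no more than multiplication by `z_i -
z_j`, and the latter product is `F - s_{ij} F`. -/
theorem divDiff_mem_restrictDegree {n d : ℕ} (i j : Fin n) (h : i ≠ j) (c : ℂ)
    {F : MvPolynomial (Fin n) ℂ} (hF : F ∈ restrictDegree (Fin n) ℂ d) :
    (C c * X i - X j) * divDiff i j h F ∈ restrictDegree (Fin n) ℂ d := by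
  -- Partial degrees add only for nonzero factors.
  rcases eq_or_ne (divDiff i j h F) 0 with h0 | h0
  · rw [h0, mul_zero]; exact zero_mem _
  have hs : (X i - X j) * divDiff i j h F ∈ restrictDegree (Fin n) ℂ d := by
    rw [X_sub_X_mul_divDiff]
    exact sub_mem hF (swapVar_mem_restrictDegree i j hF)
  rw [mem_restrictDegree_iff_degreeOf] at hs ⊢
  intro k
  have e := hs k
  rw [degreeOf_mul_eq (X_sub_X_ne_zero h) h0] at e
  exact (degreeOf_mul_le _ _ _).trans ((Nat.add_le_add_right (degreeOf_X_sub_X h k c) _).trans e)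

theorem demazureLusztig_mem_restrictDegree {n d : ℕ} (s : ℂˣ) (i j : Fin n) (h : i ≠ j)
    {F : MvPolynomial (Fin n) ℂ} (hF : F ∈ restrictDegree (Fin n) ℂ d) :
    demazureLusztig s i j h F ∈ restrictDegree (Fin n) ℂ d := by
  rw [demazureLusztig_apply, ← smul_eq_C_mul _ (s : ℂ)⁻¹, ← smul_eq_C_mul F (s : ℂ)]
  exact add_mem (neg_mem (Submodule.smul_mem _ _ (divDiff_mem_restrictDegree i j h _ hF)))
    (Submodule.smul_mem _ _ hF)

theorem heckeOrOne_mem_restrictDegree {n d : ℕ} (s : ℂˣ) (k : ℕ)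
    {F : MvPolynomial (Fin n) ℂ} (hF : F ∈ restrictDegree (Fin n) ℂ d) :
    (heckeOrOne n s k).val F ∈ restrictDegree (Fin n) ℂ d := by
  unfold heckeOrOne
  split_ifs with hk
  · have e : (heckeT (N := n) s k hk).val =
        demazureLusztig s ⟨k, by omega⟩ ⟨k + 1, hk⟩ (by simp) := rfl
    rw [e]
    exact demazureLusztig_mem_restrictDegree s _ _ _ hF
  · exact hF

theorem heckeOrOne_inv_mem_restrictDegree {n d : ℕ} (s : ℂˣ) (k : ℕ)
    {F : MvPolynomial (Fin n) ℂ} (hF : F ∈ restrictDegree (Fin n) ℂ d) :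
    (heckeOrOne n s k)⁻¹.val F ∈ restrictDegree (Fin n) ℂ d := by
  unfold heckeOrOne
  split_ifs with hk
  · have e : (heckeT (N := n) s k hk)⁻¹.val =
        demazureLusztig s ⟨k, by omega⟩ ⟨k + 1, hk⟩ (by simp) - ((s : ℂ) - (s : ℂ)⁻¹) • 1 := rfl
    rw [e, LinearMap.sub_apply, LinearMap.smul_apply, Module.End.one_apply]
    exact sub_mem (demazureLusztig_mem_restrictDegree s _ _ _ hF) (Submodule.smul_mem _ _ hF)
  · simpa using hF

theorem cyclicShift_mem_restrictDegree {n d : ℕ} (q : ℂ) {F : MvPolynomial (Fin n) ℂ}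
    (hF : F ∈ restrictDegree (Fin n) ℂ d) : cyclicShift n q F ∈ restrictDegree (Fin n) ℂ d := by
  rcases n with _ | n
  · rw [mem_restrictDegree_iff_degreeOf]; exact fun i => i.elim0
  have hτ : ∀ j : Fin (n + 1), ((finRotate (n + 1)).symm j : ℕ) =
      if (j : ℕ) = 0 then n else (j : ℕ) - 1 := by
    intro j
    obtain ⟨k, rfl⟩ := (finRotate (n + 1)).surjective j
    rw [Equiv.symm_apply_apply, coe_finRotate]
    split_ifs <;> simp_all [Fin.ext_iff]
  set τ := (finRotate (n + 1)).symm with hτd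
  rw [cyclicShift, AlgHom.toLinearMap_apply, aeval_def, eval₂_eq']
  refine sum_mem fun m hm => ?_
  rw [algebraMap_eq, ← smul_eq_C_mul]
  refine Submodule.smul_mem _ _ ?_
  rw [mem_restrictDegree_iff_degreeOf]
  intro k
  -- The substitution permutes the variables by `τ` up to scalars. Only an upper bound is available,
  -- since `q` may be `0`.
  have hb : ∀ j : Fin (n + 1), degreeOf k (if (j : ℕ) = 0 then
      C q * X (⟨n + 1 - 1, by omega⟩ : Fin (n + 1))
      else X (⟨(j : ℕ) - 1, by have := j.2; omega⟩ : Fin (n + 1)) : MvPolynomial (Fin (n + 1)) ℂ) ≤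
        if k = τ j then 1 else 0 := by
    intro j
    have hX : ∀ l : Fin (n + 1), degreeOf k (X l : MvPolynomial (Fin (n + 1)) ℂ) =
        if k = l then 1 else 0 :=
      fun l => degreeOf_X k l
    split_ifs with h1 h2 h2
    · refine (degreeOf_C_mul_le _ _ _).trans ?_
      rw [hX]; split_ifs <;> simp
    · refine (degreeOf_C_mul_le _ _ _).trans ?_
      rw [hX, if_neg]
      simpa [Fin.ext_iff, hτ, h1] using h2
    · rw [hX]; split_ifs <;> simp
    · rw [hX, if_neg]
      simpa [Fin.ext_iff, hτ, h1] using h2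
  refine (degreeOf_prod_le _ _ _).trans ?_
  calc _ ≤ ∑ j, m j * (if k = τ j then 1 else 0) := Finset.sum_le_sum fun j _ =>
        (degreeOf_pow_le _ _ _).trans (Nat.mul_le_mul_left _ (hb j))
    _ = m (τ.symm k) := by
        rw [Finset.sum_eq_single (τ.symm k)]
        · simp
        · intro j _ hj
          rw [if_neg, mul_zero]
          rintro rfl
          simp at hj
        · simp
    _ ≤ d := (mem_restrictDegree _ _ _).1 hF m hm _

theorem cherednikY_mem_restrictDegree {n d : ℕ} (s : ℂˣ) (q : ℂ) (i : Fin n)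
    {F : MvPolynomial (Fin n) ℂ} (hF : F ∈ restrictDegree (Fin n) ℂ d) :
    cherednikY s q i F ∈ restrictDegree (Fin n) ℂ d := by
  rw [cherednikY_eq, Module.End.mul_apply, Module.End.mul_apply]
  exact prod_map_mem _ _ _ (fun k _ _ h => heckeOrOne_mem_restrictDegree s k h)
    (cyclicShift_mem_restrictDegree q
      (prod_map_mem _ _ _ (fun k _ _ h => heckeOrOne_inv_mem_restrictDegree s k h) hF))

/-! ### Evaluation at points and vanishing at the roots of unity -/

theorem aeval_swapVar {N : ℕ} (w : Fin N → ℂ) (i j : Fin N) (F : MvPolynomial (Fin N) ℂ) :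
    aeval w (swapVar i j F) = aeval (w ∘ Equiv.swap i j) F := by
  rw [swapVar, aeval_rename]

theorem aeval_demazureLusztig {N : ℕ} (s : ℂˣ) (i j : Fin N) (h : i ≠ j) (w : Fin N → ℂ)
    (hw : w i ≠ w j) (F : MvPolynomial (Fin N) ℂ) :
    aeval w (demazureLusztig s i j h F) =
      (s : ℂ)⁻¹ * ((1 - (s : ℂ) ^ 2) * w j / (w i - w j) * aeval w F +
        ((s : ℂ) ^ 2 * w i - w j) / (w i - w j) * aeval (w ∘ Equiv.swap i j) F) := by
  have e := congrArg (aeval w) (X_sub_X_mul_demazureLusztig s i j h F)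
  simp only [map_mul, map_sub, map_add, map_one, aeval_X, aeval_C, Algebra.algebraMap_self,
    RingHom.id_apply, aeval_swapVar] at e
  have hw' := sub_ne_zero.2 hw
  apply mul_left_cancel₀ hw'
  rw [e]
  field_simp

theorem aeval_heckeOrOne {N : ℕ} (s : ℂˣ) {k : ℕ} (hk : k + 1 < N) (w : Fin N → ℂ)
    (hw : Function.Injective w) (F : MvPolynomial (Fin N) ℂ) :
    aeval w ((heckeOrOne N s k).val F) =
      (s : ℂ)⁻¹ * ((1 - (s : ℂ) ^ 2) * w ⟨k + 1, hk⟩ / (w ⟨k, by omega⟩ - w ⟨k + 1, hk⟩) *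
          aeval w F +
        ((s : ℂ) ^ 2 * w ⟨k, by omega⟩ - w ⟨k + 1, hk⟩) / (w ⟨k, by omega⟩ - w ⟨k + 1, hk⟩) *
          aeval (w ∘ Equiv.swap ⟨k, by omega⟩ ⟨k + 1, hk⟩) F) := by
  have h : (⟨k, by omega⟩ : Fin N) ≠ ⟨k + 1, hk⟩ := by simp
  have e : (heckeOrOne N s k).val = demazureLusztig s ⟨k, by omega⟩ ⟨k + 1, hk⟩ h := by
    rw [heckeOrOne, dif_pos hk]; rfl
  rw [e, aeval_demazureLusztig s _ _ h w (hw.ne h)]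

theorem aeval_cyclicShift {N : ℕ} (q : ℂ) (w : Fin N → ℂ) (F : MvPolynomial (Fin N) ℂ) :
    aeval w (cyclicShift N q F) = aeval (fun j : Fin N =>
      if (j : ℕ) = 0 then q * w ⟨N - 1, by have := j.2; omega⟩
      else w ⟨(j : ℕ) - 1, by have := j.2; omega⟩) F := by
  rw [cyclicShift, AlgHom.toLinearMap_apply, ← AlgHom.comp_apply, comp_aeval]
  congr 2
  funext j
  split_ifs <;> simp

/-- The points with distinct coordinates that are `N`th roots of unity. -/
def IsRootPoint {N : ℕ} (w : Fin N → ℂ) : Prop :=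
  Function.Injective w ∧ ∀ i, w i ^ N = 1

/-- The polynomials vanishing at all arrangements of the `N`th roots of unity. -/
def rootKernel (N : ℕ) : Submodule ℂ (MvPolynomial (Fin N) ℂ) where
  carrier := {F | ∀ w : Fin N → ℂ, IsRootPoint w → aeval w F = 0}
  add_mem' {F G} hF hG w hw := by rw [map_add, hF w hw, hG w hw, add_zero]
  zero_mem' w _ := map_zero _
  smul_mem' c F hF w hw := by rw [map_smul, hF w hw, smul_zero]

/-- The value of `T_k F` at `w` combines the values of `F` at `w` and at a transposed `w`. This is
why the kernel must involve all arrangements of the roots, not just one. -/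
theorem heckeOrOne_mem_rootKernel {N : ℕ} (s : ℂˣ) (k : ℕ) {F : MvPolynomial (Fin N) ℂ}
    (hF : F ∈ rootKernel N) : (heckeOrOne N s k).val F ∈ rootKernel N := by
  by_cases hk : k + 1 < N
  · intro w hw
    rw [aeval_heckeOrOne s hk w hw.1, hF w hw,
      hF _ ⟨hw.1.comp (Equiv.swap _ _).injective, fun i => hw.2 _⟩]
    simp
  · simpa [heckeOrOne, hk] using hF

theorem isRootPoint_ev {N : ℕ} (σ : Equiv.Perm (Fin N)) :
    IsRootPoint fun j : Fin N =>
      Complex.exp (2 * Real.pi * Complex.I / N) ^ ((σ j : ℕ) + 1) := by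
  rcases Nat.eq_zero_or_pos N with rfl | hN
  · exact ⟨fun i => i.elim0, fun i => i.elim0⟩
  have hp : IsPrimitiveRoot (Complex.exp (2 * Real.pi * Complex.I / N)) N :=
    Complex.isPrimitiveRoot_exp N hN.ne'
  refine ⟨fun i j hij => ?_, fun i => ?_⟩
  · simp only [pow_succ] at hij
    have := hp.pow_inj (σ i).2 (σ j).2 (mul_right_cancel₀ (Complex.exp_ne_zero _) hij)
    exact σ.injective (Fin.ext this)
  · rw [pow_right_comm, hp.pow_eq_one, one_pow]

/-! ### Chains of Hecke generators as deformed divided differences -/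

/-- Replacing one node by a pair of nodes in a deformed divided difference. -/
theorem sum_deformed_divided_difference_insert {ι : Type*} [DecidableEq ι] (t : ℂ) (w : ι → ℂ)
    (S : Finset ι) (a b : ι) (hw : Function.Injective w) (hab : a ≠ b) (ha : a ∉ S) (hb : b ∉ S)
    (g : ℂ → ℂ) :
    ∑ j ∈ insert a (insert b S), g (w j) * ((∏ l ∈ insert b S, (t * w j - w l)) /
        ∏ l ∈ (insert a (insert b S)).erase j, (w j - w l)) =
      (1 - t) * w b / (w a - w b) * ∑ j ∈ insert b S, g (w j) * ((∏ l ∈ S, (t * w j - w l)) /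
        ∏ l ∈ (insert b S).erase j, (w j - w l)) +
      (t * w a - w b) / (w a - w b) * ∑ j ∈ insert a S, g (w j) * ((∏ l ∈ S, (t * w j - w l)) /
        ∏ l ∈ (insert a S).erase j, (w j - w l)) := by
  have hab' : a ∉ insert b S := by simp [hab, ha]
  have hne : ∀ {i j}, i ≠ j → w i - w j ≠ 0 := fun h => sub_ne_zero.2 (hw.ne h)
  have hS : ∀ j ∉ S, ∏ l ∈ S, (w j - w l) ≠ 0 := fun j hj =>
    Finset.prod_ne_zero_iff.2 fun l hl => hne fun h => hj (h ▸ hl)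
  have hE : ∀ j ∈ S, ∏ l ∈ S.erase j, (w j - w l) ≠ 0 := fun j _ =>
    Finset.prod_ne_zero_iff.2 fun l hl => hne (Finset.ne_of_mem_erase hl).symm
  rw [Finset.sum_insert hab', Finset.sum_insert hb, Finset.sum_insert hb, Finset.sum_insert ha,
    Finset.erase_insert hab', Finset.erase_insert hb, Finset.erase_insert ha,
    Finset.erase_insert_of_ne hab, Finset.erase_insert hb, Finset.prod_insert hb,
    Finset.prod_insert hb, Finset.prod_insert ha, Finset.prod_insert hb]
  -- For each `j ∈ S` this is the partial fraction decomposition of `(t x - w b) / ((x - w a) (x - w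
  -- b))` at `x = w j`. The terms `j = a` and `j = b` each match a single term on the right.
  have hsum : ∑ j ∈ S, g (w j) * ((∏ l ∈ insert b S, (t * w j - w l)) /
        ∏ l ∈ (insert a (insert b S)).erase j, (w j - w l)) =
      (1 - t) * w b / (w a - w b) * ∑ j ∈ S, g (w j) * ((∏ l ∈ S, (t * w j - w l)) /
        ∏ l ∈ (insert b S).erase j, (w j - w l)) +
      (t * w a - w b) / (w a - w b) * ∑ j ∈ S, g (w j) * ((∏ l ∈ S, (t * w j - w l)) /
        ∏ l ∈ (insert a S).erase j, (w j - w l)) := by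
    rw [Finset.mul_sum, Finset.mul_sum, ← Finset.sum_add_distrib]
    refine Finset.sum_congr rfl fun j hj => ?_
    have hja : a ≠ j := fun h => ha (h ▸ hj)
    have hjb : b ≠ j := fun h => hb (h ▸ hj)
    have hbE : b ∉ S.erase j := fun h => hb (Finset.mem_of_mem_erase h)
    have haE : a ∉ S.erase j := fun h => ha (Finset.mem_of_mem_erase h)
    have haE' : a ∉ insert b (S.erase j) := by simp [hab, ha]
    rw [Finset.erase_insert_of_ne hja, Finset.erase_insert_of_ne hjb,
      Finset.erase_insert_of_ne hja, Finset.prod_insert hb, Finset.prod_insert haE',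
      Finset.prod_insert hbE, Finset.prod_insert haE]
    have h1 := hE j hj
    have h2 := hne hab
    have h3 := hne hja.symm
    have h4 := hne hjb.symm
    generalize ∏ l ∈ S.erase j, (w j - w l) = E at *
    generalize ∏ l ∈ S, (t * w j - w l) = p
    field_simp
    ring
  rw [hsum]
  have h1 := hS a ha
  have h2 := hS b hb
  have h3 := hne hab
  have h4 := hne hab.symm
  generalize ∏ l ∈ S, (w a - w l) = A at *
  generalize ∏ l ∈ S, (w b - w l) = B at *
  generalize ∏ l ∈ S, (t * w a - w l) = p
  generalize ∏ l ∈ S, (t * w b - w l) = p'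
  have h5 : w b - w a = -(w a - w b) := by ring
  rw [h5]
  field_simp
  ring

/-- A chain of Hecke generators applied to a polynomial that depends, besides the first `a₀`
variables, on the last variable only. -/
theorem aeval_prod_heckeOrOne {N : ℕ} (hN : 0 < N) (s : ℂˣ) (a₀ : ℕ) (y : Fin N → ℂ)
    (F : MvPolynomial (Fin N) ℂ) (g : ℂ → ℂ)
    (hF : ∀ w : Fin N → ℂ, (∀ i : Fin N, (i : ℕ) < a₀ → w i = y i) →
      aeval w F = g (w ⟨N - 1, by omega⟩))
    (n : ℕ) (a : Fin N) (ha : a₀ ≤ a) (hn : a + n + 1 = N) (w : Fin N → ℂ)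
    (hw : Function.Injective w) (hwy : ∀ i : Fin N, (i : ℕ) < a₀ → w i = y i) :
    aeval w (((List.range' a n).map fun k => (heckeOrOne N s k).val).prod F) =
      (s : ℂ)⁻¹ ^ n * ∑ j ∈ insert a (Finset.Ioi a), g (w j) *
        ((∏ l ∈ Finset.Ioi a, ((s : ℂ) ^ 2 * w j - w l)) /
          ∏ l ∈ (insert a (Finset.Ioi a)).erase j, (w j - w l)) := by
  induction n generalizing a w with
  | zero =>
    have h0 : Finset.Ioi a = ∅ := by
      ext l
      have := l.2
      simp only [Finset.mem_Ioi, Fin.lt_def, Finset.notMem_empty, iff_false]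
      omega
    have h1 : a = ⟨N - 1, by omega⟩ := by ext; simp only; omega
    rw [h0]
    simp [hF w hwy, h1]
  | succ n ih =>
    have hk : (a : ℕ) + 1 < N := by omega
    set b : Fin N := ⟨a + 1, hk⟩ with hb
    have hab : a ≠ b := by simp [hb, Fin.ext_iff]
    have hIoi : Finset.Ioi a = insert b (Finset.Ioi b) := by
      ext l
      simp only [Finset.mem_Ioi, Finset.mem_insert, Fin.lt_def, Fin.ext_iff, hb]
      omega
    have haS : a ∉ Finset.Ioi b := by simp [hb, Fin.lt_def]
    have hbS : b ∉ Finset.Ioi b := by simp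
    rw [List.range'_succ, List.map_cons, List.prod_cons, Module.End.mul_apply,
      aeval_heckeOrOne s hk w hw]
    have i1 := ih b (by simp only [hb]; omega) (by simp only [hb]; omega) w hw hwy
    have i2 := ih b (by simp only [hb]; omega) (by simp only [hb]; omega) (w ∘ Equiv.swap a b)
      (hw.comp (Equiv.swap a b).injective) (by
        intro i hi
        have h1 : i ≠ a := by rintro rfl; omega
        have h2 : i ≠ b := by rintro rfl; simp only [hb] at hi; omega
        rw [Function.comp_apply, Equiv.swap_apply_of_ne_of_ne h1 h2, hwy i hi])
    have hsw : ∀ l ∈ Finset.Ioi b, Equiv.swap a b l = l := fun l hl =>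
      Equiv.swap_apply_of_ne_of_ne (fun h => haS (h ▸ hl)) (fun h => hbS (h ▸ hl))
    -- Transposing the coordinates of the point replaces the node `b` by `a` and leaves the later
    -- nodes fixed.
    have e2 : ∑ j ∈ insert b (Finset.Ioi b), g ((w ∘ Equiv.swap a b) j) *
        ((∏ l ∈ Finset.Ioi b, ((s : ℂ) ^ 2 * (w ∘ Equiv.swap a b) j - (w ∘ Equiv.swap a b) l)) /
          ∏ l ∈ (insert b (Finset.Ioi b)).erase j,
            ((w ∘ Equiv.swap a b) j - (w ∘ Equiv.swap a b) l)) =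
        ∑ j ∈ insert a (Finset.Ioi b), g (w j) *
        ((∏ l ∈ Finset.Ioi b, ((s : ℂ) ^ 2 * w j - w l)) /
          ∏ l ∈ (insert a (Finset.Ioi b)).erase j, (w j - w l)) := by
      have hp : ∀ u, ∏ l ∈ Finset.Ioi b, ((s : ℂ) ^ 2 * u - (w ∘ Equiv.swap a b) l) =
          ∏ l ∈ Finset.Ioi b, ((s : ℂ) ^ 2 * u - w l) := fun u =>
        Finset.prod_congr rfl fun l hl => by rw [Function.comp_apply, hsw l hl]
      rw [Finset.sum_insert hbS, Finset.sum_insert haS, Finset.erase_insert hbS,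
        Finset.erase_insert haS]
      congr 1
      · rw [hp, Function.comp_apply, Equiv.swap_apply_right]
        congr 2
        exact Finset.prod_congr rfl fun l hl => by rw [Function.comp_apply, hsw l hl]
      · refine Finset.sum_congr rfl fun j hj => ?_
        have hjb : b ≠ j := fun h => hbS (h ▸ hj)
        have hja : a ≠ j := fun h => haS (h ▸ hj)
        rw [hp, Finset.erase_insert_of_ne hjb, Finset.erase_insert_of_ne hja,
          Finset.prod_insert (by simp), Finset.prod_insert (by simp [haS])]
        rw [Function.comp_apply, Function.comp_apply, hsw j hj, Equiv.swap_apply_right]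
        congr 3
        exact Finset.prod_congr rfl fun l hl => by
          rw [Function.comp_apply, hsw l (Finset.mem_of_mem_erase hl)]
    rw [e2] at i2
    have ea : (⟨(a : ℕ), by omega⟩ : Fin N) = a := rfl
    rw [hIoi, sum_deformed_divided_difference_insert _ w _ a b hw hab haS hbS]
    simp only [ea, ← hb]
    have hba : (b : ℕ) = a + 1 := rfl
    rw [hba] at i1 i2
    rw [i1, i2, pow_succ]
    ring

/-! ### Interpolation at the roots of unity -/

theorem IsRootPoint.nodal_eq {N : ℕ} (hN : 0 < N) {w : Fin N → ℂ} (hw : IsRootPoint w) :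
    Lagrange.nodal Finset.univ w = Polynomial.X ^ N - Polynomial.C 1 := by
  have hd : (Polynomial.X ^ N - Polynomial.C (1 : ℂ)).degree = (N : WithBot ℕ) :=
    Polynomial.degree_X_pow_sub_C hN 1
  apply Polynomial.eq_of_degree_le_of_eval_index_eq (s := Finset.univ) (v := w) hw.1.injOn
  · simp [Lagrange.degree_nodal]
  · rw [hd, Lagrange.degree_nodal]; simp
  · rw [Lagrange.nodal_monic.leadingCoeff, (Polynomial.monic_X_pow_sub_C 1 hN.ne').leadingCoeff]
  · intro i hi
    rw [Lagrange.eval_nodal_at_node hi]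
    simp [hw.2 i]

/-- The product is `(x^N - 1) / (x - w a)`, a geometric sum because `w a ^ N = 1`. -/
theorem IsRootPoint.prod_erase {N : ℕ} {w : Fin N → ℂ} (hw : IsRootPoint w) (a : Fin N) (x : ℂ) :
    ∏ l ∈ Finset.univ.erase a, (x - w l) =
      ∑ i ∈ Finset.range N, x ^ i * w a ^ (N - 1 - i) := by
  have hN : 0 < N := a.pos
  have e : Lagrange.nodal (Finset.univ.erase a) w =
      ∑ i ∈ Finset.range N, Polynomial.X ^ i * Polynomial.C (w a) ^ (N - 1 - i) := by
    apply mul_left_cancel₀ (Polynomial.X_sub_C_ne_zero (w a))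
    rw [← Lagrange.nodal_eq_mul_nodal_erase (Finset.mem_univ a), hw.nodal_eq hN,
      mul_comm, (Commute.all _ _).geom_sum₂_mul, ← Polynomial.C_pow, hw.2]
  have := congrArg (Polynomial.eval x) e
  simpa [Lagrange.eval_nodal, Polynomial.eval_finsetSum] using this

/-- A duality between products over the roots of unity with one of them left out. -/
theorem IsRootPoint.prod_erase_dual {N : ℕ} {w : Fin N → ℂ} (hw : IsRootPoint w) (a j : Fin N)
    {t : ℂ} (ht : t ≠ 0) :
    ∏ l ∈ Finset.univ.erase a, (t * w j - w l) =
      t ^ (N - 1) * ∏ l ∈ Finset.univ.erase j, (t⁻¹ * w a - w l) := by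
  -- Reversing one geometric sum exchanges the roles of `w a` and `w j`.
  rw [hw.prod_erase, hw.prod_erase, Finset.mul_sum, ← Finset.sum_range_reflect]
  refine Finset.sum_congr rfl fun i hi => ?_
  rw [Finset.mem_range] at hi
  have h1 : N - 1 - (N - 1 - i) = i := by omega
  have h2 : t ^ (N - 1) = t ^ (N - 1 - i) * t ^ i := by rw [← pow_add]; congr 1; omega
  rw [h1, h2, mul_pow, mul_pow, inv_pow]
  have := pow_ne_zero i ht
  field_simp

theorem eval_eq_sum_nodes {ι : Type*} [DecidableEq ι] (S : Finset ι) (w : ι → ℂ)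
    (hw : Function.Injective w) (q : Polynomial ℂ) (hq : q.degree < S.card) (x : ℂ) :
    q.eval x = ∑ j ∈ S, q.eval (w j) *
      ((∏ l ∈ S.erase j, (x - w l)) / ∏ l ∈ S.erase j, (w j - w l)) := by
  conv_lhs => rw [Lagrange.eq_interpolate (hw.injOn (s := S)) hq]
  rw [Lagrange.interpolate_apply, Polynomial.eval_finsetSum]
  refine Finset.sum_congr rfl fun j _ => ?_
  rw [Polynomial.eval_mul, Polynomial.eval_C, Lagrange.basis, Polynomial.eval_prod,
    ← Finset.prod_div_distrib]
  congr 1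
  refine Finset.prod_congr rfl fun l _ => ?_
  simp [Lagrange.basisDivisor, div_eq_mul_inv, mul_comm]

/-- At the roots of unity a deformed divided difference is a single value. -/
theorem IsRootPoint.sum_deformed_divided_difference {N : ℕ} {w : Fin N → ℂ} (hw : IsRootPoint w)
    (s : ℂˣ) (a : Fin N) (q : Polynomial ℂ) (hq : q.natDegree ≤ N - 1 - a) :
    (s : ℂ)⁻¹ ^ (N - 1 - a : ℕ) * ∑ j ∈ insert a (Finset.Ioi a),
        ((∏ i ∈ Finset.Iio a, ((s : ℂ) ^ 2 * w j - w i)) * q.eval (w j)) *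
        ((∏ l ∈ Finset.Ioi a, ((s : ℂ) ^ 2 * w j - w l)) /
          ∏ l ∈ (insert a (Finset.Ioi a)).erase j, (w j - w l)) =
      (-1) ^ (a : ℕ) * (s : ℂ) ^ (N - 1 - a : ℕ) *
        ((∏ i ∈ Finset.Iio a, ((s : ℂ) ^ 2 * w i - w a)) *
          q.eval (((s : ℂ) ^ 2)⁻¹ * w a)) := by
  set t := (s : ℂ) ^ 2 with ht
  have ht0 : t ≠ 0 := pow_ne_zero _ s.ne_zero
  have haN := a.2
  -- There are `N - a` nodes, one more than the bound on the degree of `q`; this is where the degree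
  -- restriction is needed.
  have hdeg : q.degree < (insert a (Finset.Ioi a)).card := by
    rw [Finset.card_insert_of_notMem (by simp), Fin.card_Ioi]
    refine (Polynomial.degree_le_of_natDegree_le hq).trans_lt ?_
    exact_mod_cast Nat.lt_succ_self _
  rw [eval_eq_sum_nodes _ w hw.1 q hdeg, Finset.mul_sum, Finset.mul_sum, Finset.mul_sum]
  refine Finset.sum_congr rfl fun j hj => ?_
  have e := hw.prod_erase_dual a j ht0
  have hj' : a ≤ j := by
    simp only [Finset.mem_insert, Finset.mem_Ioi] at hj
    exact hj.elim (fun h => h.ge) le_of_lt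
  have s1 : Finset.univ.erase a = Finset.Iio a ∪ Finset.Ioi a := by
    ext l; simp [lt_or_lt_iff_ne]
  have d1 : Disjoint (Finset.Iio a) (Finset.Ioi a) := by
    rw [Finset.disjoint_left]; intro l h1 h2
    exact absurd (Finset.mem_Iio.1 h1) (Finset.mem_Ioi.1 h2).not_gt
  have s2 : Finset.univ.erase j = Finset.Iio a ∪ (insert a (Finset.Ioi a)).erase j := by
    ext l
    simp only [Finset.mem_erase, Finset.mem_univ, and_true, Finset.mem_union, Finset.mem_Iio,
      Finset.mem_insert, Finset.mem_Ioi, Fin.lt_def, Fin.le_def, Fin.ext_iff, ne_eq] at hj' ⊢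
    omega
  have d2 : Disjoint (Finset.Iio a) ((insert a (Finset.Ioi a)).erase j) := by
    rw [Finset.disjoint_left]; intro l h1 h2
    simp only [Finset.mem_erase, Finset.mem_Iio, Finset.mem_insert, Finset.mem_Ioi, Fin.lt_def,
      Fin.ext_iff] at h1 h2
    omega
  rw [s1, s2, Finset.prod_union d1, Finset.prod_union d2] at e
  -- The factors at the earlier positions become those of `Δ_t` with `w a` in the last slot; this
  -- produces the sign.
  have hlow : t ^ (a : ℕ) * ∏ l ∈ Finset.Iio a, (t⁻¹ * w a - w l) =
      (-1) ^ (a : ℕ) * ∏ l ∈ Finset.Iio a, (t * w l - w a) := by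
    have hc : (Finset.Iio a).card = (a : ℕ) := Fin.card_Iio a
    conv_lhs => rw [← hc]
    conv_rhs => rw [← hc]
    rw [← Finset.prod_const, ← Finset.prod_mul_distrib, ← Finset.prod_const,
      ← Finset.prod_mul_distrib]
    refine Finset.prod_congr rfl fun l _ => ?_
    field_simp
    ring
  have hpow : t ^ (N - 1) = t ^ (a : ℕ) * t ^ (N - 1 - a : ℕ) := by
    rw [← pow_add]; congr 1; omega
  have hs : (s : ℂ)⁻¹ ^ (N - 1 - a : ℕ) * t ^ (N - 1 - a : ℕ) = (s : ℂ) ^ (N - 1 - a : ℕ) := by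
    rw [← mul_pow, ht, pow_two, inv_mul_cancel_left₀ s.ne_zero]
  calc _ = (s : ℂ)⁻¹ ^ (N - 1 - a : ℕ) * (((∏ l ∈ Finset.Iio a, (t * w j - w l)) *
          ∏ l ∈ Finset.Ioi a, (t * w j - w l)) * (q.eval (w j) /
            ∏ l ∈ (insert a (Finset.Ioi a)).erase j, (w j - w l))) := by ring
    _ = (s : ℂ)⁻¹ ^ (N - 1 - a : ℕ) * t ^ (N - 1 - a : ℕ) *
          (t ^ (a : ℕ) * ∏ l ∈ Finset.Iio a, (t⁻¹ * w a - w l)) *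
          ((∏ l ∈ (insert a (Finset.Ioi a)).erase j, (t⁻¹ * w a - w l)) * (q.eval (w j) /
            ∏ l ∈ (insert a (Finset.Ioi a)).erase j, (w j - w l))) := by
        rw [e, hpow]; ring
    _ = _ := by rw [hs, hlow]; ring

/-! ### Splitting one variable off the deformed Vandermonde polynomial -/

theorem aeval_qVandermonde {M : ℕ} (s : ℂˣ) (v : Fin M → ℂ) :
    aeval v (qVandermonde M s) = (s : ℂ)⁻¹ ^ (M * (M - 1) / 2) *
      ∏ i, ∏ j, if i < j then (s : ℂ) ^ 2 * v i - v j else 1 := by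
  rw [qVandermonde, map_mul, map_prod, aeval_C]
  congr 1
  refine Finset.prod_congr rfl fun i _ => ?_
  rw [map_prod, ← Finset.prod_filter]
  refine Finset.prod_congr ?_ fun j _ => ?_
  · ext j; simp
  · simp

/-- The two ways of splitting off one variable from the deformed Vandermonde product. -/
theorem aeval_qVandermonde_cons {m : ℕ} (s : ℂˣ) (v : Fin m → ℂ) (x : ℂ) :
    aeval (Fin.cons x v : Fin (m + 1) → ℂ) (qVandermonde (m + 1) s) =
      (s : ℂ)⁻¹ ^ ((m + 1) * (m + 1 - 1) / 2) *
        (∏ i, ∏ j, if i < j then (s : ℂ) ^ 2 * v i - v j else 1) *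
        ∏ i, ((s : ℂ) ^ 2 * x - v i) := by
  rw [aeval_qVandermonde, mul_assoc]
  congr 1
  rw [Fin.prod_univ_succ, Fin.prod_univ_succ]
  simp [Fin.prod_univ_succ (n := m), mul_comm]

theorem aeval_qVandermonde_snoc {m : ℕ} (s : ℂˣ) (v : Fin m → ℂ) (x : ℂ) :
    aeval (Fin.snoc v x : Fin (m + 1) → ℂ) (qVandermonde (m + 1) s) =
      (s : ℂ)⁻¹ ^ ((m + 1) * (m + 1 - 1) / 2) *
        (∏ i, ∏ j, if i < j then (s : ℂ) ^ 2 * v i - v j else 1) *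
        ∏ i, ((s : ℂ) ^ 2 * v i - x) := by
  rw [aeval_qVandermonde, mul_assoc]
  congr 1
  rw [Fin.prod_univ_castSucc]
  simp [Fin.prod_univ_castSucc (n := m), Finset.prod_mul_distrib,
    (Fin.le_last _).not_gt]

/-- Restriction of a polynomial to a line parallel to the first coordinate axis. -/
theorem exists_eval_eq_aeval_cons {m d : ℕ} {Q : MvPolynomial (Fin (m + 1)) ℂ}
    (hQ : Q ∈ restrictDegree (Fin (m + 1)) ℂ d) (v : Fin m → ℂ) :
    ∃ q : Polynomial ℂ, q.natDegree ≤ d ∧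
      ∀ x, q.eval x = aeval (Fin.cons x v : Fin (m + 1) → ℂ) Q := by
  refine ⟨aeval (Fin.cons Polynomial.X fun i => Polynomial.C (v i) :
    Fin (m + 1) → Polynomial ℂ) Q, ?_, fun x => ?_⟩
  · rw [aeval_def, eval₂_eq']
    refine Polynomial.natDegree_sum_le_of_forall_le _ _ fun e he => ?_
    rw [Polynomial.algebraMap_eq]
    refine (Polynomial.natDegree_C_mul_le _ _).trans ?_
    rw [Fin.prod_univ_succ]
    simp only [Fin.cons_zero, Fin.cons_succ, ← Polynomial.C_pow, ← map_prod]
    refine (Polynomial.natDegree_mul_C_le _ _).trans ?_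
    rw [Polynomial.natDegree_X_pow]
    exact (mem_restrictDegree _ _ _).1 hQ e he 0
  · have : Polynomial.eval x (aeval (Fin.cons Polynomial.X fun i => Polynomial.C (v i) :
        Fin (m + 1) → Polynomial ℂ) Q) = Polynomial.aeval x (aeval (Fin.cons Polynomial.X
          fun i => Polynomial.C (v i) : Fin (m + 1) → Polynomial ℂ) Q) := by
      rw [Polynomial.coe_aeval_eq_eval]
    rw [this, ← AlgHom.comp_apply, comp_aeval]
    congr 2
    funext i
    refine Fin.cases ?_ (fun i => ?_) i <;> simp

/-! ### The identity at the roots of unity -/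

/-- The chain of the last Hecke generators, applied to the cyclic shift. -/
theorem prod_heckeOrOne_cyclicShift_sub_mem_rootKernel {m N : ℕ} (hMN : m + 1 ≤ N) (s : ℂˣ)
    {Q : MvPolynomial (Fin (m + 1)) ℂ}
    (hQ : Q ∈ restrictDegree (Fin (m + 1)) ℂ (N - (m + 1))) :
    ((List.range' m (N - (m + 1))).map fun k => (heckeOrOne N s k).val).prod
        (cyclicShift N 1 (vandermondeIncl hMN s Q)) -
      ((-1) ^ m * (s : ℂ) ^ (N - (m + 1))) •
        vandermondeIncl hMN s (cyclicShift (m + 1) ((s : ℂ) ^ 2)⁻¹ Q) ∈ rootKernel N := by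
  intro w hw
  have hN : 0 < N := by omega
  set a : Fin N := ⟨m, by omega⟩ with ha
  set v : Fin m → ℂ := fun i => w (Fin.castLE (by omega) i) with hv
  obtain ⟨q, hqd, hq⟩ := exists_eval_eq_aeval_cons hQ v
  -- The part of `Δ_t` in the first `m` coordinates is the same whether the extra variable is put
  -- first, as `π` does, or last.
  set c : ℂ := (s : ℂ)⁻¹ ^ ((m + 1) * (m + 1 - 1) / 2) *
        (∏ i, ∏ j, if i < j then (s : ℂ) ^ 2 * v i - v j else 1) with hc
  have hprod : ∀ f : Fin N → ℂ, ∏ i : Fin m, f (Fin.castLE (by omega) i) =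
      ∏ i ∈ Finset.Iio a, f i := by
    intro f
    refine Finset.prod_bij' (fun i _ => Fin.castLE (by omega) i)
      (fun i hi => ⟨i, by simpa [ha, Fin.lt_def] using hi⟩) ?_ ?_ ?_ ?_ ?_ <;>
      simp [ha, Fin.lt_def]
  have hk : N - (m + 1) = N - 1 - (a : ℕ) := by simp only [ha]; omega
  -- With `q = 1`, the shift puts the last coordinate into the first slot and moves the first `m`
  -- coordinates up by one, so the point seen by `Δ_t Q` is a `Fin.cons`.
  have hF : ∀ w' : Fin N → ℂ, (∀ i : Fin N, (i : ℕ) < m → w' i = w i) →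
      aeval w' (cyclicShift N 1 (vandermondeIncl hMN s Q)) =
        (fun u => c * ((∏ i ∈ Finset.Iio a, ((s : ℂ) ^ 2 * u - w i)) * q.eval u))
          (w' ⟨N - 1, by omega⟩) := by
    intro w' hw'
    rw [aeval_cyclicShift, vandermondeIncl_apply, incl, aeval_rename]
    have e : ((fun j : Fin N => if (j : ℕ) = 0 then 1 * w' ⟨N - 1, by have := j.2; omega⟩
      else w' ⟨(j : ℕ) - 1, by have := j.2; omega⟩) ∘ Fin.castLE hMN) =
        (Fin.cons (w' ⟨N - 1, by omega⟩) v : Fin (m + 1) → ℂ) := by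
      funext i
      refine Fin.cases (by simp) (fun i => ?_) i
      simp [hv, hw' ⟨i, by omega⟩ i.2, Fin.castLE]
    rw [e, map_mul, aeval_qVandermonde_cons, ← hq, ← hc,
      show ∏ i, ((s : ℂ) ^ 2 * w' ⟨N - 1, by omega⟩ - v i) = _ from
        hprod fun i => (s : ℂ) ^ 2 * w' ⟨N - 1, by omega⟩ - w i]
    ring
  have hR : aeval w (vandermondeIncl hMN s (cyclicShift (m + 1) ((s : ℂ) ^ 2)⁻¹ Q)) =
      c * ((∏ i ∈ Finset.Iio a, ((s : ℂ) ^ 2 * w i - w a)) *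
          q.eval (((s : ℂ) ^ 2)⁻¹ * w a)) := by
    rw [vandermondeIncl_apply, incl, aeval_rename, map_mul, aeval_cyclicShift]
    have e1 : w ∘ Fin.castLE hMN = (Fin.snoc v (w a) : Fin (m + 1) → ℂ) := by
      funext i
      refine Fin.lastCases ?_ (fun i => ?_) i
      · simp [ha, Fin.castLE]
      · simp [hv, Fin.castLE]
    have e2 : (fun j : Fin (m + 1) => if (j : ℕ) = 0 then
        ((s : ℂ) ^ 2)⁻¹ * (w ∘ Fin.castLE hMN) ⟨m + 1 - 1, by have := j.2; omega⟩
        else (w ∘ Fin.castLE hMN) ⟨(j : ℕ) - 1, by have := j.2; omega⟩) =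
        (Fin.cons (((s : ℂ) ^ 2)⁻¹ * w a) v : Fin (m + 1) → ℂ) := by
      funext i
      refine Fin.cases (by simp [ha, Fin.castLE]) (fun i => ?_) i
      simp [hv, Fin.castLE]
    rw [e2, e1, aeval_qVandermonde_snoc, ← hq, ← hc,
      show ∏ i, ((s : ℂ) ^ 2 * v i - w a) = _ from hprod fun i => (s : ℂ) ^ 2 * w i - w a]
    ring
  rw [map_sub, map_smul, hR, aeval_prod_heckeOrOne hN s m w _ (fun u => c * ((∏ i ∈ Finset.Iio a,
    ((s : ℂ) ^ 2 * u - w i)) * q.eval u)) hF _ a le_rfl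
    (by simp only [ha]; omega) w hw.1 fun _ _ => rfl]
  have main := hw.sum_deformed_divided_difference s a q (hk ▸ hqd)
  rw [← hk] at main
  have e : ∀ G : Fin N → ℂ, ∑ j ∈ insert a (Finset.Ioi a),
      c * ((∏ i ∈ Finset.Iio a, ((s : ℂ) ^ 2 * w j - w i)) * q.eval (w j)) * G j =
      c * ∑ j ∈ insert a (Finset.Ioi a),
      ((∏ i ∈ Finset.Iio a, ((s : ℂ) ^ 2 * w j - w i)) * q.eval (w j)) * G j := by
    intro G
    rw [Finset.mul_sum]
    exact Finset.sum_congr rfl fun j _ => by ring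
  rw [e, smul_eq_mul]
  linear_combination c * main

theorem cherednikY_vandermondeIncl_sub_mem_rootKernel {M N : ℕ} (hMN : M ≤ N) (s : ℂˣ) (i : Fin M)
    {P : MvPolynomial (Fin M) ℂ} (hP : P ∈ restrictDegree (Fin M) ℂ (N - M)) :
    cherednikY s 1 (Fin.castLE hMN i) (vandermondeIncl hMN s P) -
      (s : ℂ) ^ (N - M) • vandermondeIncl hMN s (cherednikY s⁻¹ ((s : ℂ) ^ 2)⁻¹ i P) ∈
        rootKernel N := by
  obtain ⟨m, rfl⟩ : ∃ m, M = m + 1 := ⟨M - 1, by have := i.2; omega⟩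
  have hi := i.2
  set Q := ((List.range i).map fun k => (heckeOrOne (m + 1) s⁻¹ k)⁻¹.val).prod P with hQd
  have hQ : Q ∈ restrictDegree (Fin (m + 1)) ℂ (N - (m + 1)) :=
    prod_map_mem _ _ _ (fun k _ _ h => heckeOrOne_inv_mem_restrictDegree s⁻¹ k h) hP
  have core := prod_heckeOrOne_cyclicShift_sub_mem_rootKernel hMN s hQ
  have hinv : ((List.range i).map fun k => (heckeOrOne N s k)⁻¹.val).prod
      (vandermondeIncl hMN s P) = (-1 : ℂ) ^ (i : ℕ) • vandermondeIncl hMN s Q := by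
    have := prod_map_apply_of_anticomm (vandermondeIncl hMN s)
      (fun k => (heckeOrOne N s k)⁻¹.val) (fun k => (heckeOrOne (m + 1) s⁻¹ k)⁻¹.val)
      (List.range i) (fun k hk v => heckeOrOne_inv_incl_qVandermonde_mul hMN s
        (by rw [List.mem_range] at hk; omega) v) P
    rwa [List.length_range] at this
  have hfwd : ∀ R, ((List.range' i (m - i)).map fun k => (heckeOrOne N s k).val).prod
      (vandermondeIncl hMN s R) = (-1 : ℂ) ^ (m - i : ℕ) • vandermondeIncl hMN s
        (((List.range' i (m - i)).map fun k => (heckeOrOne (m + 1) s⁻¹ k).val).prod R) := by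
    intro R
    have := prod_map_apply_of_anticomm (vandermondeIncl hMN s)
      (fun k => (heckeOrOne N s k).val) (fun k => (heckeOrOne (m + 1) s⁻¹ k).val)
      (List.range' i (m - i)) (fun k hk v => heckeOrOne_incl_qVandermonde_mul hMN s
        (by rw [List.mem_range'_1] at hk; omega) v) R
    rwa [List.length_range'] at this
  -- Positions below `m = M - 1` act within the first `M` variables and pass through `Δ_t`; the
  -- others form the chain handled by `core`.
  have hsplit : List.range' i (N - 1 - i) =
      List.range' i (m - i) ++ List.range' m (N - (m + 1)) := by
    have h1 : m = i + (m - i) := by omega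
    have h2 : N - 1 - (i : ℕ) = (m - i) + (N - (m + 1)) := by omega
    rw [h2, ← List.range'_append_1, ← h1]
  rw [cherednikY_eq, cherednikY_eq, Fin.val_castLE, hsplit, List.map_append, List.prod_append]
  simp only [Module.End.mul_apply, add_tsub_cancel_right]
  rw [hinv, ← hQd, map_smul, map_smul, map_smul]
  -- The congruence `core` survives the outer Hecke generators because they preserve `rootKernel N`.
  have K := Submodule.smul_mem _ ((-1 : ℂ) ^ (i : ℕ))
    (prod_map_mem (rootKernel N) (fun k => (heckeOrOne N s k).val) (List.range' i (m - i))
      (fun k _ _ h => heckeOrOne_mem_rootKernel s k h) core)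
  rw [map_sub, map_smul, hfwd, smul_sub, smul_smul, smul_smul] at K
  -- The signs come from the `i` inverse generators, the interpolation, and the `m - i` outer
  -- generators; their product is `(-1)^{2m} = 1`.
  have hsign : (-1 : ℂ) ^ (i : ℕ) * ((-1) ^ m * (s : ℂ) ^ (N - (m + 1))) * (-1) ^ (m - i : ℕ) =
      (s : ℂ) ^ (N - (m + 1)) := by
    have h1 : (-1 : ℂ) ^ (i : ℕ) * (-1) ^ (m - i : ℕ) = (-1) ^ m := by
      rw [← pow_add]; congr 1; omega
    have h2 : (-1 : ℂ) ^ m * (-1) ^ m = 1 := by rw [← mul_pow]; simp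
    linear_combination (-1) ^ m * (s : ℂ) ^ (N - (m + 1)) * h1 + (s : ℂ) ^ (N - (m + 1)) * h2
  rwa [hsign] at K

end QHS

end

theorem theorem3p15 (N M : ℕ) (hMN : M ≤ N) (s : ℂˣ) (m : Fin M) :
    (∀ P ∈ MvPolynomial.restrictDegree (Fin M) ℂ (N - M),
      QHS.cherednikY s⁻¹ ((s : ℂ) ^ 2)⁻¹ m P ∈
        MvPolynomial.restrictDegree (Fin M) ℂ (N - M)) ∧
    (∀ σ : Equiv.Perm (Fin N), ∀ P ∈ MvPolynomial.restrictDegree (Fin M) ℂ (N - M),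
      QHS.ev N σ (QHS.cherednikY s 1 (Fin.castLE hMN m)
          (QHS.incl hMN (QHS.qVandermonde M s * P))) =
        QHS.ev N σ (QHS.incl hMN
          ((s : ℂ) ^ (N - M) •
            (QHS.qVandermonde M s * QHS.cherednikY s⁻¹ ((s : ℂ) ^ 2)⁻¹ m P)))) := by
  refine ⟨fun P hP => QHS.cherednikY_mem_restrictDegree _ _ _ hP, fun σ P hP => ?_⟩
  have h := QHS.cherednikY_vandermondeIncl_sub_mem_rootKernel hMN s m hP _ (QHS.isRootPoint_ev σ)
  rw [map_sub, sub_eq_zero] at h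
  rw [map_smul (QHS.incl hMN)]
  exact h
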